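/- **Theorem (finite-time convergence of blurring mean shift, e.g. for the Epanechnikov kernel).** Let $K:\mathbb{R}^d\to\mathbb{R}$ be a bounded, continuous, non-negative function with $\int K=1$ that is radially symmetric, $K(u)=k(\|u\|^2/2)$, where the profile $k:[0,\infty)\to\mathbb{R}$ is convex and non-increasing with right derivative $k'(0+)>-\infty$. Let $g$ satisfy $g(0)=-k'(0+)$ and $g(u)\in-\partial k(u)$ for $u>0$, where $\partial k(u)=\{c\in\mathbb{R}: k(v)\ge k(u)+c(v-u)\ \forall v\ge 0\}$, and put $G(u)=g(\|u\|^2/2)$. Given data points $x_1,\dots,x_n\in\mathbb{R}^d$ and a bandwidth $h>0$, the blurring mean-shift (BMS) algorithm generates configurations $y_t=(y_{t,1},\dots,y_{t,n})$ by $y_{1,i}=x_i$ and $$y_{t+1,i}=\frac{\sum_{j=1}^n G\big(\tfrac{y_{t,i}-y_{t,j}}{h}\big)\,y_{t,j}}{\sum_{j=1}^n G\big(\tfrac{y_{t,i}-y_{t,j}}{h}\big)},\qquad i=1,\dots,n,\ t=1,2,\dots$$ For a configuration $u=(u_1,\dots,u_n)$ let $\mathcal{G}_u$ be the graph on $\{1,\dots,n\}$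 in which distinct $i,j$ are joined if and only if $G(\frac{u_i-u_j}{h})\ne0$, and let $L(u)=\sum_{i,j=1}^n K(\frac{u_i-u_j}{h})$. Let $\beta=\sup\{u\ge0: k(u^2/2)\ne0\}$. Assume that $K$ is non-smoothly truncated, i.e. $\beta<\infty$ and $u\mapsto k(u^2/2)$ is not differentiable at $u=\beta$, and that there is $\beta'\in(0,\beta]$ such that $k(u^2/2)=k(0)+\frac{k'(0+)}{2}u^2$ for all $u\in[0,\beta']$. Then the BMS algorithm converges after finitely many iterations: the limit $\bar y=\lim_{t\to\infty}y_t$ exists and there is $\tau\in\mathbb{N}$ such that $\mathcal{G}_{y_t}=\mathcal{G}_{\bar y}$ for all $t\ge\tau$; moreover, if $\mathcal{V}_1,\dots,\mathcal{V}_M$ are the vertex sets of the connected components of $\mathcal{G}_{y_\tau}$, there are $M$ distinct points $z_1,\dots,z_M\in\mathbb{R}^d$ such that, for every $t\ge\tau$, $y_t=\bar y$, $y_{t,i}=z_m$ for all $i\in\mathcal{V}_m$ and all $m=1,\dots,M$, and $L(y_t)=L(\bar y)$. The assumptions on the kernel hold, for example, for the Epanechnikov kernel, i.e. the normalized multiple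 of $(1-\|u\|^2)_+$ on $\mathbb{R}^d$, with the profile $k(u)$ proportional to $(1-2u)_+$. -/

import Mathlib

noncomputable section

namespace BMS

/-- Points of `ℝ^d`, with the Euclidean norm. -/
abbrev Point (d : ℕ) : Type := EuclideanSpace ℝ (Fin d)

/-- Configurations of `n` points in `ℝ^d`. -/
abbrev Config (n d : ℕ) : Type := Fin n → Point d

/-- The right derivative `k'(0+)` of a profile at the origin.  Profiles are functions on `[0, ∞)`;
they are written as functions `ℝ → ℝ` whose values at negative numbers are never used. -/
def rightDerivZero (k : ℝ → ℝ) : ℝ := derivWithin k (Set.Ioi 0) 0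

/-- The standing assumption on the kernel `K` and its profile `k`. -/
structure IsKernelWithProfile {d : ℕ} (K : Point d → ℝ) (k : ℝ → ℝ) : Prop where
  bounded : ∃ C : ℝ, ∀ u, |K u| ≤ C
  continuous : Continuous K
  nonneg : ∀ u, 0 ≤ K u
  integrable : MeasureTheory.Integrable K MeasureTheory.volume
  normalized : ∫ u, K u = 1
  radial : ∀ u, K u = k (‖u‖ ^ 2 / 2)
  convex : ConvexOn ℝ (Set.Ici 0) k
  nonincreasing : AntitoneOn k (Set.Ici 0)
  /-- `k'(0+) > -∞`: the difference quotients at `0` have a finite limit from the right. -/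
  rightDeriv_finite : DifferentiableWithinAt ℝ k (Set.Ioi 0) 0

/-- The subdifferential at `u` of a function `k` on `[0, ∞)`. -/
def subdifferential (k : ℝ → ℝ) (u : ℝ) : Set ℝ :=
  {c | ∀ v : ℝ, 0 ≤ v → k u + c * (v - u) ≤ k v}

/-- `g(0) = -k'(0+)`, and `g(u) ∈ -∂k(u)` for `u > 0`. -/
structure IsWeightOf (g k : ℝ → ℝ) : Prop where
  zero : g 0 = -rightDerivZero k
  pos : ∀ u : ℝ, 0 < u → -g u ∈ subdifferential k u

/-- The radially symmetric function `G(u) = g(‖u‖² / 2)`. -/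
def radialWeight {d : ℕ} (g : ℝ → ℝ) (u : Point d) : ℝ := g (‖u‖ ^ 2 / 2)

/-- The truncation point `β = sup {u ≥ 0 | k(u² / 2) ≠ 0}`, possibly infinite. -/
def truncationPoint (k : ℝ → ℝ) : ENNReal :=
  ⨆ (u : ℝ) (_ : 0 ≤ u ∧ k (u ^ 2 / 2) ≠ 0), ENNReal.ofReal u

/-- `β < ∞`, and `u ↦ k(u² / 2)` is not differentiable at `β`. -/
def IsNonSmoothlyTruncated (k : ℝ → ℝ) : Prop :=
  truncationPoint k < ⊤ ∧
    ¬ DifferentiableAt ℝ (fun u : ℝ => k (u ^ 2 / 2)) (truncationPoint k).toReal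

/-- For some `β' ∈ (0, β]`, `k(u² / 2) = k(0) + (k'(0+) / 2) u²` on `[0, β']`. -/
def IsQuadraticNearZero (k : ℝ → ℝ) : Prop :=
  ∃ β' : ℝ, 0 < β' ∧ ENNReal.ofReal β' ≤ truncationPoint k ∧
    ∀ u ∈ Set.Icc 0 β', k (u ^ 2 / 2) = k 0 + rightDerivZero k / 2 * u ^ 2

/-- One update of the blurring mean-shift algorithm with bandwidth `h`. -/
def step {n d : ℕ} (g : ℝ → ℝ) (h : ℝ) (u : Config n d) : Config n d := fun i =>
  (∑ j, radialWeight g (h⁻¹ • (u i - u j)))⁻¹ •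
    ∑ j, radialWeight g (h⁻¹ • (u i - u j)) • u j

/-- The configuration sequence of the algorithm started at the data `x`; the initial
configuration is the term with index `0`. -/
def sequence {n d : ℕ} (g : ℝ → ℝ) (h : ℝ) (x : Config n d) : ℕ → Config n d
  | 0 => x
  | t + 1 => step g h (sequence g h x t)

/-- The BMS graph of a configuration. -/
def graph {n d : ℕ} (g : ℝ → ℝ) (h : ℝ) (u : Config n d) : SimpleGraph (Fin n) where
  Adj i j := i ≠ j ∧ radialWeight g (h⁻¹ • (u i - u j)) ≠ 0
  symm := ⟨fun i j hij => ⟨hij.1.symm, by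
    simpa only [radialWeight, norm_smul, norm_sub_rev (u j) (u i)] using hij.2⟩⟩
  loopless := ⟨fun _ hi => hi.1 rfl⟩

/-- The objective function `L(u) = ∑ᵢⱼ K((uᵢ - uⱼ) / h)`. -/
def objective {n d : ℕ} (K : Point d → ℝ) (h : ℝ) (u : Config n d) : ℝ :=
  ∑ i, ∑ j, K (h⁻¹ • (u i - u j))

/-- The normalizing constant of the Epanechnikov kernel on `ℝ^d`. -/
def epanechnikovConst (d : ℕ) : ℝ := (∫ v : Point d, max (1 - ‖v‖ ^ 2) 0)⁻¹

/-- The Epanechnikov kernel on `ℝ^d`, the normalized multiple of `(1 - ‖u‖²)₊`. -/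
def epanechnikovKernel (d : ℕ) (u : Point d) : ℝ :=
  epanechnikovConst d * max (1 - ‖u‖ ^ 2) 0

/-- The profile of the Epanechnikov kernel. -/
def epanechnikovProfile (d : ℕ) (u : ℝ) : ℝ :=
  epanechnikovConst d * max (1 - 2 * u) 0

end BMS

end

/-! One step replaces each point by a weighted average. The subgradient inequality for the profile
bounds the gain of `L` below by the loss of the weighted energy `∑ wᵢⱼ ‖yᵢ - yⱼ‖²` with frozen
weights, hence by a multiple of the squared displacements (`displacement_le_objective_sub`). As `L`
is bounded, displacements tend to `0`. The points stay bounded, so the energy is at most linear in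
the displacements and also tends to `0` (`tendsto_energy`).

Non-smooth truncation keeps the nonzero values of `g` away from `0`
(`IsWeightOf.exists_lower_bound`), so all edges become short. A profile affine near `0` makes `g`
constant there (`IsWeightOf.eq_zero_of_affine`): once edges are short enough, adjacency is
transitive and all edges have weight `g 0`. Neighbors then average the same points with the same
weights, coincide after one more step (`exists_coincide`), and the configuration is fixed. -/

open Filter Topology

namespace BMS

/-! ### Convex profiles and their subgradient weights. -/

section Profile

variable {k g : ℝ → ℝ}

/-- The subgradient inequality for the weight, the origin included. -/
lemma IsWeightOf.subgradient (hg : IsWeightOf g k) (hconv : ConvexOn ℝ (Set.Ici 0) k)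
    (hd : DifferentiableWithinAt ℝ k (Set.Ioi 0) 0) {s v : ℝ} (hs : 0 ≤ s) (hv : 0 ≤ v) :
    k s - g s * (v - s) ≤ k v := by
  rcases hs.eq_or_lt with rfl | hs
  · rcases hv.eq_or_lt with rfl | hv
    · simp
    · have h := hconv.le_slope_of_hasDerivWithinAt_Ioi (by simp) (Set.mem_Ici.2 hv.le) hv
        hd.hasDerivWithinAt
      rw [slope_def_field, le_div_iff₀ (by linarith)] at h
      rw [hg.zero, rightDerivZero]
      linarith
  · have h := hg.pos s hs v hv
    linarith

lemma IsWeightOf.nonneg (hg : IsWeightOf g k) (hconv : ConvexOn ℝ (Set.Ici 0) k)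
    (hd : DifferentiableWithinAt ℝ k (Set.Ioi 0) 0) (hanti : AntitoneOn k (Set.Ici 0))
    {s : ℝ} (hs : 0 ≤ s) : 0 ≤ g s := by
  have h := hg.subgradient hconv hd hs (by linarith : 0 ≤ s + 1)
  have h' := hanti (Set.mem_Ici.2 hs) (Set.mem_Ici.2 (by linarith : 0 ≤ s + 1)) (by linarith)
  linarith

lemma IsWeightOf.le_zero (hg : IsWeightOf g k) (hconv : ConvexOn ℝ (Set.Ici 0) k)
    (hd : DifferentiableWithinAt ℝ k (Set.Ioi 0) 0) {s : ℝ} (hs : 0 ≤ s) : g s ≤ g 0 := by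
  rcases hs.eq_or_lt with rfl | hs
  · rfl
  · have h₁ := hg.subgradient hconv hd le_rfl hs.le
    have h₂ := hg.subgradient hconv hd hs.le le_rfl
    nlinarith

lemma eq_zero_of_truncationPoint_lt (hk : truncationPoint k < ⊤) {u : ℝ}
    (hu : (truncationPoint k).toReal < u) : k (u ^ 2 / 2) = 0 := by
  by_contra hne
  have hu0 : 0 ≤ u := ENNReal.toReal_nonneg.trans hu.le
  have h : ENNReal.ofReal u ≤ truncationPoint k :=
    le_iSup₂ (f := fun (u : ℝ) (_ : 0 ≤ u ∧ k (u ^ 2 / 2) ≠ 0) => ENNReal.ofReal u) u ⟨hu0, hne⟩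
  exact hu.not_ge ((ENNReal.ofReal_le_iff_le_toReal hk.ne).1 h)

/-- If the profile vanishes from a point on without being flat there, then a weight is bounded
below before that point and vanishes after it. -/
lemma IsWeightOf.exists_lower_bound (hg : IsWeightOf g k) (hconv : ConvexOn ℝ (Set.Ici 0) k)
    (hd : DifferentiableWithinAt ℝ k (Set.Ioi 0) 0) (hanti : AntitoneOn k (Set.Ici 0))
    {B : ℝ} (hB : 0 < B) (hzero : ∀ s, B < s → k s = 0) (hns : ¬ HasDerivAt k 0 B) :
    ∃ c > 0, (∀ s, 0 ≤ s → s < B → c ≤ g s) ∧ ∀ s, B < s → g s = 0 := by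
  have hkB : k B = 0 := by
    apply le_antisymm
    · by_contra! hpos
      have hgB := hg.nonneg hconv hd hanti hB.le
      -- Continuity of `k` at `B` is not assumed. Over this step the supporting line falls by at
      -- most `k B / 2`, so it would stay positive where `k` vanishes; the `+ 1` covers `g B = 0`.
      have hv : B < B + k B / (2 * (g B + 1)) := by
        have : 0 < k B / (2 * (g B + 1)) := by positivity
        linarith
      have h := hg.subgradient hconv hd hB.le (hB.le.trans hv.le)
      rw [hzero _ hv] at h
      have h2 : g B * (k B / (2 * (g B + 1))) ≤ k B / 2 := by
        rw [← mul_div_assoc, div_le_div_iff₀ (by positivity) (by norm_num)]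
        nlinarith
      have h3 : B + k B / (2 * (g B + 1)) - B = k B / (2 * (g B + 1)) := by ring
      rw [h3] at h
      linarith
    · rw [← hzero (B + 1) (by linarith)]
      exact hanti (Set.mem_Ici.2 hB.le) (Set.mem_Ici.2 (by linarith)) (by linarith)
  have hnn : ∀ s, 0 ≤ s → 0 ≤ k s := fun s hs => by
    rcases le_or_gt s B with h | h
    · rw [← hkB]; exact hanti (Set.mem_Ici.2 hs) (Set.mem_Ici.2 hB.le) h
    · exact (hzero s h).ge
  rw [hasDerivAt_iff_isLittleO, Asymptotics.isLittleO_iff] at hns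
  push Not at hns
  obtain ⟨c, hc, hfreq⟩ := hns
  refine ⟨c, hc, fun s hs hsB => ?_, fun s hs => ?_⟩
  -- Choose `s'` beyond `s` with `k s' > c |s' - B|`; it lies left of `B`, as `k` vanishes from `B`
  -- on. By convexity the chord from `s` to `B` is at least as steep as the one from `s'`, and `g s`
  -- is at least the steepness of the former.
  · obtain ⟨s', hs'1, hs'2⟩ := (hfreq.and_eventually (lt_mem_nhds hsB)).exists
    have hs'0 : 0 ≤ s' := hs.trans hs'2.le
    simp only [hkB, smul_zero, sub_zero, Real.norm_eq_abs, abs_of_nonneg (hnn s' hs'0)] at hs'1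
    have hs'B : s' < B := by
      by_contra! hle
      have : k s' = 0 := by
        rcases hle.eq_or_lt with h | h
        · rw [← h, hkB]
        · exact hzero _ h
      rw [this] at hs'1
      exact absurd hs'1 (not_lt.2 (by positivity))
    rw [abs_of_neg (by linarith)] at hs'1
    have hch := hconv.2 (Set.mem_Ici.2 hs) (Set.mem_Ici.2 hB.le)
      (div_nonneg (by linarith) (by linarith) : 0 ≤ (B - s') / (B - s))
      (div_nonneg (by linarith) (by linarith) : 0 ≤ (s' - s) / (B - s))
      (by rw [← add_div, div_eq_one_iff_eq (by linarith)]; ring)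
    have hpt : ((B - s') / (B - s)) • s + ((s' - s) / (B - s)) • B = s' := by
      have : B - s ≠ 0 := by linarith
      simp only [smul_eq_mul]; field_simp; ring
    rw [hpt, hkB, smul_zero, add_zero, smul_eq_mul, div_mul_eq_mul_div,
      le_div_iff₀ (by linarith)] at hch
    have hsub := hg.subgradient hconv hd hs hB.le
    rw [hkB] at hsub
    have h1 : c * (B - s') * (B - s) ≤ (B - s') * (g s * (B - s)) := by nlinarith
    have h2 : (B - s') * (B - s) * c ≤ (B - s') * (B - s) * g s := by linarith
    exact le_of_mul_le_mul_left h2 (mul_pos (by linarith) (by linarith))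
  · have h := hg.subgradient hconv hd (hB.le.trans hs.le) (by linarith : 0 ≤ (s + B) / 2)
    rw [hzero s hs, hzero ((s + B) / 2) (by linarith)] at h
    have h' := hg.nonneg hconv hd hanti (hB.le.trans hs.le)
    nlinarith

/-- A weight of a profile that is affine on `[0, b]` is constant on `[0, b)`. -/
lemma IsWeightOf.eq_zero_of_affine (hg : IsWeightOf g k) (hconv : ConvexOn ℝ (Set.Ici 0) k)
    (hd : DifferentiableWithinAt ℝ k (Set.Ioi 0) 0) {b : ℝ}
    (haff : ∀ s, 0 ≤ s → s ≤ b → k s = k 0 - g 0 * s) {s : ℝ} (hs : 0 ≤ s) (hsb : s < b) :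
    g s = g 0 := by
  apply le_antisymm (hg.le_zero hconv hd hs)
  -- Testing at the endpoint `b` gives `g 0 * (b - s) ≤ g s * (b - s)`.
  have h := hg.subgradient hconv hd hs (hs.trans hsb.le)
  rw [haff s hs hsb.le, haff b (hs.trans hsb.le) le_rfl] at h
  nlinarith

/-- The properties of a weight from which finite-time convergence follows. -/
structure IsRegularWeight (g k : ℝ → ℝ) (c b : ℝ) : Prop where
  subgradient : ∀ s v, 0 ≤ s → 0 ≤ v → k s - g s * (v - s) ≤ k v
  le_profile_zero : ∀ s, 0 ≤ s → k s ≤ k 0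
  nonneg : ∀ s, 0 ≤ s → 0 ≤ g s
  le_zero : ∀ s, 0 ≤ s → g s ≤ g 0
  zero_pos : 0 < g 0
  lower_bound_pos : 0 < c
  lower_bound : ∀ s, 0 ≤ s → g s ≠ 0 → c ≤ g s
  radius_pos : 0 < b
  eq_zero : ∀ s, 0 ≤ s → s < b → g s = g 0

lemma IsWeightOf.exists_isRegularWeight (hg : IsWeightOf g k) (hconv : ConvexOn ℝ (Set.Ici 0) k)
    (hd : DifferentiableWithinAt ℝ k (Set.Ioi 0) 0) (hanti : AntitoneOn k (Set.Ici 0))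
    (htr : IsNonSmoothlyTruncated k) (hq : IsQuadraticNearZero k) :
    ∃ c b : ℝ, IsRegularWeight g k c b := by
  obtain ⟨htop, hnd⟩ := htr
  obtain ⟨β', hβ', hle, hquad⟩ := hq
  set β := (truncationPoint k).toReal with hβdef
  have hββ : β' ≤ β := (ENNReal.ofReal_le_iff_le_toReal htop.ne).1 hle
  have hβ : 0 < β := hβ'.trans_le hββ
  have hB : 0 < β ^ 2 / 2 := by positivity
  have hzero : ∀ s, β ^ 2 / 2 < s → k s = 0 := fun s hs => by
    have h := eq_zero_of_truncationPoint_lt htop (u := √(2 * s))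
      (Real.lt_sqrt_of_sq_lt (by linarith))
    rwa [Real.sq_sqrt (by linarith), mul_div_cancel_left₀ _ (two_ne_zero)] at h
  obtain ⟨c, hc, hlow, hhigh⟩ := hg.exists_lower_bound hconv hd hanti hB hzero fun hder =>
    hnd (HasDerivAt.comp β (h₂ := k) (h := fun u : ℝ => u ^ 2 / 2) hder
      (((hasDerivAt_id β).pow 2).div_const 2)).differentiableAt
  have hnn : ∀ s, 0 ≤ s → 0 ≤ g s := fun s hs => hg.nonneg hconv hd hanti hs
  have haff : ∀ s, 0 ≤ s → s ≤ β' ^ 2 / 2 → k s = k 0 - g 0 * s := fun s hs hsb => by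
    have h := hquad (√(2 * s)) ⟨Real.sqrt_nonneg _, Real.sqrt_le_iff.2 ⟨hβ'.le, by linarith⟩⟩
    rw [Real.sq_sqrt (by linarith), mul_div_cancel_left₀ _ (two_ne_zero)] at h
    rw [h, hg.zero]; ring
  have hcommon : ∀ c', 0 < c' → (∀ s, 0 ≤ s → g s ≠ 0 → c' ≤ g s) →
      ∃ c b : ℝ, IsRegularWeight g k c b := fun c' hc' hl =>
    ⟨c', β' ^ 2 / 2, fun s v hs hv => hg.subgradient hconv hd hs hv,
      fun s hs => hanti (by simp) (Set.mem_Ici.2 hs) hs, hnn,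
      fun s hs => hg.le_zero hconv hd hs, hc.trans_le (hlow 0 le_rfl hB), hc', hl, by positivity,
      fun s hs hsb => hg.eq_zero_of_affine hconv hd haff hs hsb⟩
  -- At the kink `β ^ 2 / 2` any subgradient is allowed, so `g` may be zero there or positive but
  -- below `c`; in the positive case its value enters the bound.
  rcases (hnn _ hB.le).eq_or_lt with h0 | h0
  · refine hcommon c hc fun s hs hne => ?_
    rcases lt_trichotomy s (β ^ 2 / 2) with h | rfl | h
    · exact hlow s hs h
    · exact absurd h0.symm hne
    · exact absurd (hhigh s h) hne
  · refine hcommon (min c (g (β ^ 2 / 2))) (lt_min hc h0) fun s hs hne => ?_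
    rcases lt_trichotomy s (β ^ 2 / 2) with h | rfl | h
    · exact (min_le_left _ _).trans (hlow s hs h)
    · exact min_le_right _ _
    · exact absurd (hhigh s h) hne

end Profile

end BMS

namespace BMS

/-! ### Energy estimates for symmetric weighted averaging. -/

section Averaging

variable {ι E : Type*} [Fintype ι] [NormedAddCommGroup E] [InnerProductSpace ℝ E]
  {w : ι → ι → ℝ} {y y' : ι → E}

/-- Replacing each point by its weighted average decreases the weighted energy by
`∑ wᵢⱼ ‖δᵢ + δⱼ‖²`, where `δ` is the displacement. -/
lemma energy_sub_energy_average (hsymm : ∀ i j, w i j = w j i)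
    (havg : ∀ i, ∑ j, w i j • (y' i - y j) = 0) :
    ∑ i, ∑ j, w i j * (‖y i - y j‖ ^ 2 - ‖y' i - y' j‖ ^ 2) =
      ∑ i, ∑ j, w i j * ‖(y' i - y i) + (y' j - y j)‖ ^ 2 := by
  have h0 : ∑ i, ∑ j, w i j * inner ℝ (y' i - y i) (y' i - y j) = 0 :=
    Finset.sum_eq_zero fun i _ => by
      simp_rw [← inner_smul_right, ← inner_sum, havg i, inner_zero_right]
  have h1 : ∑ i, ∑ j, w i j * inner ℝ (y' j - y j) (y' j - y i) = 0 := by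
    rw [Finset.sum_comm, ← h0]
    exact Finset.sum_congr rfl fun i _ => Finset.sum_congr rfl fun j _ => by rw [hsymm]
  -- The expansion is arranged so that its cross terms are exactly those annihilated by the
  -- averaging condition in `h0` and `h1`.
  have key : ∀ i j, w i j * (‖y i - y j‖ ^ 2 - ‖y' i - y' j‖ ^ 2) =
      w i j * ‖(y' i - y i) + (y' j - y j)‖ ^ 2
        - 2 * (w i j * inner ℝ (y' i - y i) (y' i - y j))
        - 2 * (w i j * inner ℝ (y' j - y j) (y' j - y i)) := fun i j => by
    simp only [← real_inner_self_eq_norm_sq, inner_sub_left, inner_sub_right, inner_add_left,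
      inner_add_right]
    rw [real_inner_comm (y j) (y i), real_inner_comm (y' i) (y i), real_inner_comm (y' j) (y i),
      real_inner_comm (y' i) (y j), real_inner_comm (y' j) (y j), real_inner_comm (y' j) (y' i)]
    ring
  simp_rw [key, Finset.sum_sub_distrib, ← Finset.mul_sum]
  rw [h0, h1]; ring

/-- Only the diagonal terms of the energy identity are kept: for `i = j` the summand is `a * ‖2 δᵢ‖
^ 2`, where `δᵢ = y' i - y i`. -/
lemma four_mul_sum_le_energy_sub (hsymm : ∀ i j, w i j = w j i) (hnn : ∀ i j, 0 ≤ w i j)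
    {a : ℝ} (hdiag : ∀ i, w i i = a) (havg : ∀ i, ∑ j, w i j • (y' i - y j) = 0) :
    4 * a * ∑ i, ‖y' i - y i‖ ^ 2 ≤
      ∑ i, ∑ j, w i j * (‖y i - y j‖ ^ 2 - ‖y' i - y' j‖ ^ 2) := by
  rw [energy_sub_energy_average hsymm havg, Finset.mul_sum]
  refine Finset.sum_le_sum fun i _ => ?_
  refine le_trans (le_of_eq ?_) (Finset.single_le_sum
    (f := fun j => w i j * ‖(y' i - y i) + (y' j - y j)‖ ^ 2)
    (fun j _ => mul_nonneg (hnn i j) (sq_nonneg _)) (Finset.mem_univ i))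
  simp only [hdiag, ← two_smul ℝ (y' i - y i), norm_smul]
  norm_num; ring

/-- By symmetry the energy is `2 ∑ wᵢⱼ ⟪yᵢ, yᵢ - yⱼ⟫`, and averaging turns `∑ⱼ wᵢⱼ (yᵢ - yⱼ)` into
the total weight at `i` times `yᵢ - y'ᵢ`; Cauchy–Schwarz concludes. -/
lemma energy_le_displacement (hsymm : ∀ i j, w i j = w j i) (hnn : ∀ i j, 0 ≤ w i j)
    {a R : ℝ} (hle : ∀ i j, w i j ≤ a) (hR : ∀ i, ‖y i‖ ≤ R)
    (havg : ∀ i, ∑ j, w i j • (y' i - y j) = 0) :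
    ∑ i, ∑ j, w i j * ‖y i - y j‖ ^ 2 ≤
      2 * (R * (Fintype.card ι * a)) * ∑ i, ‖y' i - y i‖ := by
  have h1 : ∑ i, ∑ j, w i j * inner ℝ (y j) (y i - y j) =
      -∑ i, ∑ j, w i j * inner ℝ (y i) (y i - y j) := by
    rw [Finset.sum_comm, ← Finset.sum_neg_distrib]
    refine Finset.sum_congr rfl fun i _ => ?_
    rw [← Finset.sum_neg_distrib]
    refine Finset.sum_congr rfl fun j _ => ?_
    rw [hsymm, ← neg_sub (y i), inner_neg_right]; ring
  have h2 : ∑ i, ∑ j, w i j * ‖y i - y j‖ ^ 2 =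
      2 * ∑ i, ∑ j, w i j * inner ℝ (y i) (y i - y j) := by
    have : ∀ i j, w i j * ‖y i - y j‖ ^ 2 =
        w i j * inner ℝ (y i) (y i - y j) - w i j * inner ℝ (y j) (y i - y j) := fun i j => by
      rw [← real_inner_self_eq_norm_sq, inner_sub_left]; ring
    simp_rw [this, Finset.sum_sub_distrib]
    rw [h1]; ring
  rw [h2, mul_assoc]
  refine mul_le_mul_of_nonneg_left ?_ zero_le_two
  rw [Finset.mul_sum]
  refine Finset.sum_le_sum fun i _ => ?_
  have h3 : ∑ j, w i j • (y i - y j) = (∑ j, w i j) • (y i - y' i) := by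
    rw [← sub_eq_zero, Finset.sum_smul, ← Finset.sum_sub_distrib]
    simpa [← smul_sub] using havg i
  have h4 : ∑ j, w i j * inner ℝ (y i) (y i - y j) = (∑ j, w i j) * inner ℝ (y i) (y i - y' i) := by
    simp_rw [← inner_smul_right, ← inner_sum, h3]
  rw [h4]
  have h5 : ∑ j, w i j ≤ Fintype.card ι * a := by
    simpa using Finset.sum_le_card_nsmul Finset.univ (w i) a fun j _ => hle i j
  have h6 : inner ℝ (y i) (y i - y' i) ≤ R * ‖y' i - y i‖ := by
    rw [norm_sub_rev]
    exact (real_inner_le_norm _ _).trans (mul_le_mul_of_nonneg_right (hR i) (norm_nonneg _))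
  have h7 : 0 ≤ R := (norm_nonneg _).trans (hR i)
  have h8 : 0 ≤ ∑ j, w i j := Finset.sum_nonneg fun j _ => hnn i j
  calc (∑ j, w i j) * inner ℝ (y i) (y i - y' i)
      ≤ (∑ j, w i j) * (R * ‖y' i - y i‖) := mul_le_mul_of_nonneg_left h6 h8
    _ ≤ (Fintype.card ι * a) * (R * ‖y' i - y i‖) := mul_le_mul_of_nonneg_right h5 (by positivity)
    _ = R * (Fintype.card ι * a) * ‖y' i - y i‖ := by ring

end Averaging

/-! ### Asymptotics of the iteration and collapse in finite time. -/

section Dynamics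

variable {n d : ℕ} {k g : ℝ → ℝ} {c b h : ℝ}

lemma radialWeight_smul_sub_comm (g : ℝ → ℝ) (h : ℝ) (u v : Point d) :
    radialWeight g (h⁻¹ • (u - v)) = radialWeight g (h⁻¹ • (v - u)) := by
  simp only [radialWeight, norm_smul, norm_sub_rev u v]

lemma step_eq_of_radialWeight_eq {u : Config n d} {i j : Fin n}
    (hij : ∀ l, radialWeight g (h⁻¹ • (u i - u l)) = radialWeight g (h⁻¹ • (u j - u l))) :
    step g h u i = step g h u j := by
  simp only [step, hij]

namespace IsRegularWeight

variable (hg : IsRegularWeight g k c b)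
include hg

lemma radialWeight_nonneg (u : Point d) : 0 ≤ radialWeight g u := hg.nonneg _ (by positivity)

lemma sum_pos (u : Config n d) (i : Fin n) :
    0 < ∑ j, radialWeight g (h⁻¹ • (u i - u j)) :=
  Finset.sum_pos' (fun _ _ => hg.radialWeight_nonneg _)
    ⟨i, Finset.mem_univ _, by simpa [radialWeight] using hg.zero_pos⟩

lemma sum_smul_step_sub (u : Config n d) (i : Fin n) :
    ∑ j, radialWeight g (h⁻¹ • (u i - u j)) • (step g h u i - u j) = 0 := by
  rw [Finset.sum_congr rfl fun j _ => smul_sub _ _ _, Finset.sum_sub_distrib, ← Finset.sum_smul,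
    step, smul_smul, mul_inv_cancel₀ (hg.sum_pos u i).ne', one_smul, sub_self]

lemma norm_step_le {R : ℝ} {u : Config n d} (hu : ∀ i, ‖u i‖ ≤ R) (i : Fin n) :
    ‖step g h u i‖ ≤ R := by
  have hpos := hg.sum_pos (h := h) u i
  rw [step, norm_smul, norm_inv, Real.norm_of_nonneg hpos.le, inv_mul_le_iff₀ hpos,
    Finset.sum_mul]
  refine norm_sum_le_of_le _ fun j _ => ?_
  rw [norm_smul, Real.norm_of_nonneg (hg.radialWeight_nonneg _)]
  exact mul_le_mul_of_nonneg_left (hu j) (hg.radialWeight_nonneg _)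

lemma exists_norm_sequence_le (x : Config n d) :
    ∃ R : ℝ, ∀ t i, ‖sequence g h x t i‖ ≤ R := by
  refine ⟨∑ i, ‖x i‖, fun t => ?_⟩
  induction t with
  | zero =>
    intro i
    exact Finset.single_le_sum (f := fun i => ‖x i‖) (fun _ _ => norm_nonneg _)
      (Finset.mem_univ i)
  | succ t ih => exact hg.norm_step_le ih

/-- The subgradient inequality, summed over pairs, bounds the gain below by `h⁻¹ ^ 2 / 2` times the
energy loss, which is at least `4 * g 0` times the squared displacement. -/
lemma displacement_le_objective_sub (hh : 0 < h) (u : Config n d) :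
    2 * g 0 * h⁻¹ ^ 2 * ∑ i, ‖step g h u i - u i‖ ^ 2 ≤
      objective (fun v => k (‖v‖ ^ 2 / 2)) h (step g h u) -
        objective (fun v => k (‖v‖ ^ 2 / 2)) h u := by
  have h1 := four_mul_sum_le_energy_sub (w := fun i j => radialWeight g (h⁻¹ • (u i - u j)))
    (fun i j => radialWeight_smul_sub_comm g h _ _) (fun i j => hg.radialWeight_nonneg _)
    (a := g 0) (fun i => by simp [radialWeight]) (hg.sum_smul_step_sub (h := h) u)
  have h2 : h⁻¹ ^ 2 / 2 * ∑ i, ∑ j, radialWeight g (h⁻¹ • (u i - u j)) *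
        (‖u i - u j‖ ^ 2 - ‖step g h u i - step g h u j‖ ^ 2) ≤
      objective (fun v => k (‖v‖ ^ 2 / 2)) h (step g h u) -
        objective (fun v => k (‖v‖ ^ 2 / 2)) h u := by
    simp only [objective, Finset.mul_sum, ← Finset.sum_sub_distrib]
    refine Finset.sum_le_sum fun i _ => Finset.sum_le_sum fun j _ => ?_
    have h3 := hg.subgradient (‖h⁻¹ • (u i - u j)‖ ^ 2 / 2)
      (‖h⁻¹ • (step g h u i - step g h u j)‖ ^ 2 / 2) (by positivity) (by positivity)
    refine le_trans (le_of_eq ?_) (le_sub_iff_add_le'.2 ((sub_eq_add_neg _ _).symm.trans_le h3))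
    simp only [radialWeight, norm_smul, mul_pow, norm_inv, Real.norm_of_nonneg hh.le]
    ring
  refine le_trans ?_ h2
  refine le_trans (le_of_eq ?_) (mul_le_mul_of_nonneg_left h1 (by positivity))
  ring

/-- The objective is monotone along the iteration and bounded by `n ^ 2 * k 0`, so its increments
tend to `0`. -/
lemma tendsto_displacement (hh : 0 < h) (x : Config n d) :
    Tendsto (fun t => ∑ i, ‖sequence g h x (t + 1) i - sequence g h x t i‖ ^ 2) atTop (𝓝 0) := by
  set F : ℕ → ℝ := fun t => objective (fun v => k (‖v‖ ^ 2 / 2)) h (sequence g h x t) with hF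
  set C := 2 * g 0 * h⁻¹ ^ 2 with hC
  have hCpos : 0 < C := by have := hg.zero_pos; positivity
  have hstep : ∀ t, C * ∑ i, ‖sequence g h x (t + 1) i - sequence g h x t i‖ ^ 2 ≤
      F (t + 1) - F t := fun t => hg.displacement_le_objective_sub hh _
  have hmono : Monotone F := monotone_nat_of_le_succ fun t => by
    have := hstep t
    have : 0 ≤ C * ∑ i, ‖sequence g h x (t + 1) i - sequence g h x t i‖ ^ 2 := by positivity
    linarith
  have hbdd : BddAbove (Set.range F) := by
    refine ⟨∑ _i : Fin n, ∑ _j : Fin n, k 0, ?_⟩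
    rintro _ ⟨t, rfl⟩
    exact Finset.sum_le_sum fun i _ => Finset.sum_le_sum fun j _ =>
      hg.le_profile_zero _ (by positivity)
  have hlim := tendsto_atTop_ciSup hmono hbdd
  have hdiff : Tendsto (fun t => C⁻¹ * (F (t + 1) - F t)) atTop (𝓝 0) := by
    simpa using ((hlim.comp (tendsto_add_atTop_nat 1)).sub hlim).const_mul C⁻¹
  refine squeeze_zero (fun t => by positivity) (fun t => ?_) hdiff
  rw [← div_eq_inv_mul, le_div_iff₀' hCpos]
  exact hstep t

lemma tendsto_step_norm (hh : 0 < h) (x : Config n d) (i : Fin n) :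
    Tendsto (fun t => ‖sequence g h x (t + 1) i - sequence g h x t i‖) atTop (𝓝 0) := by
  have h2 : Tendsto (fun t => ‖sequence g h x (t + 1) i - sequence g h x t i‖ ^ 2)
      atTop (𝓝 0) :=
    squeeze_zero (fun t => by positivity) (fun t => Finset.single_le_sum
      (f := fun i => ‖sequence g h x (t + 1) i - sequence g h x t i‖ ^ 2)
      (fun _ _ => by positivity) (Finset.mem_univ i)) (hg.tendsto_displacement hh x)
  simpa using h2.sqrt

lemma tendsto_energy (hh : 0 < h) (x : Config n d) :
    Tendsto (fun t => ∑ i, ∑ j, radialWeight g (h⁻¹ • (sequence g h x t i - sequence g h x t j)) *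
      ‖sequence g h x t i - sequence g h x t j‖ ^ 2) atTop (𝓝 0) := by
  obtain ⟨R, hR⟩ := hg.exists_norm_sequence_le (h := h) x
  refine squeeze_zero (fun t => Finset.sum_nonneg fun i _ => Finset.sum_nonneg fun j _ =>
    mul_nonneg (hg.radialWeight_nonneg _) (by positivity)) (fun t =>
    energy_le_displacement (a := g 0) (fun i j => radialWeight_smul_sub_comm g h _ _)
      (fun i j => hg.radialWeight_nonneg _) (fun i j => hg.le_zero _ (by positivity)) (hR t)
      (hg.sum_smul_step_sub (h := h) _)) ?_
  have hlim := (tendsto_finsetSum Finset.univ fun i _ => hg.tendsto_step_norm hh x i).const_mul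
    (2 * (R * (Fintype.card (Fin n) * g 0)))
  rwa [Finset.sum_const_zero, mul_zero] at hlim

lemma eventually_short_edges (hh : 0 < h) (x : Config n d) {ε : ℝ} (hε : 0 < ε) :
    ∀ᶠ t in atTop, (∀ i, ‖sequence g h x (t + 1) i - sequence g h x t i‖ < ε) ∧
      ∀ i j, radialWeight g (h⁻¹ • (sequence g h x t i - sequence g h x t j)) ≠ 0 →
        ‖sequence g h x t i - sequence g h x t j‖ < ε := by
  have hc := hg.lower_bound_pos
  have h1 : ∀ᶠ t in atTop, ∀ i, ‖sequence g h x (t + 1) i - sequence g h x t i‖ < ε :=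
    eventually_all.2 fun i => (hg.tendsto_step_norm hh x i).eventually (gt_mem_nhds hε)
  filter_upwards [h1, (hg.tendsto_energy hh x).eventually
    (gt_mem_nhds (by positivity : 0 < c * ε ^ 2))] with t ht he
  refine ⟨ht, fun i j hij => ?_⟩
  have hnn : ∀ i j, 0 ≤ radialWeight g (h⁻¹ • (sequence g h x t i - sequence g h x t j)) *
      ‖sequence g h x t i - sequence g h x t j‖ ^ 2 := fun i j =>
    mul_nonneg (hg.radialWeight_nonneg _) (by positivity)
  have h2 := (Finset.single_le_sum (fun j _ => hnn i j) (Finset.mem_univ j)).trans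
    (Finset.single_le_sum (fun i _ => Finset.sum_nonneg fun j _ => hnn i j) (Finset.mem_univ i))
  -- A single edge of length at least `ε` would already contribute `c * ε ^ 2` to the energy.
  have h3 := hg.lower_bound _ (by positivity) hij
  have h4 := (mul_le_mul_of_nonneg_right h3
    (sq_nonneg ‖sequence g h x t i - sequence g h x t j‖)).trans_lt (h2.trans_lt he)
  exact lt_of_pow_lt_pow_left₀ 2 hε.le (lt_of_mul_lt_mul_left h4 hc.le)

lemma radialWeight_eq_zero_of_norm_lt (hh : 0 < h) {u : Point d} (hu : ‖u‖ < h * √(2 * b)) :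
    radialWeight g (h⁻¹ • u) = g 0 := by
  have hb := hg.radius_pos
  refine hg.eq_zero _ (by positivity) ?_
  have h1 : ‖h⁻¹ • u‖ < √(2 * b) := by
    rwa [norm_smul, norm_inv, Real.norm_of_nonneg hh.le, inv_mul_lt_iff₀ hh]
  have h2 := pow_lt_pow_left₀ h1 (norm_nonneg _) two_ne_zero
  rw [Real.sq_sqrt (by positivity)] at h2
  linarith

lemma step_eq_self {u : Config n d}
    (hu : ∀ i j, radialWeight g (h⁻¹ • (u i - u j)) ≠ 0 → u i = u j) : step g h u = u := by
  funext i
  have h1 : ∀ j, radialWeight g (h⁻¹ • (u i - u j)) • u j =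
      radialWeight g (h⁻¹ • (u i - u j)) • u i := fun j => by
    by_cases hz : radialWeight g (h⁻¹ • (u i - u j)) = 0
    · rw [hz, zero_smul, zero_smul]
    · rw [← hu i j hz]
  simp_rw [step, h1, ← Finset.sum_smul, smul_smul]
  rw [inv_mul_cancel₀ (hg.sum_pos u i).ne', one_smul]

/-- After finitely many iterations all neighbors in the BMS graph coincide. -/
lemma exists_coincide (hh : 0 < h) (x : Config n d) :
    ∃ τ, ∀ i j, radialWeight g (h⁻¹ • (sequence g h x τ i - sequence g h x τ j)) ≠ 0 →
      sequence g h x τ i = sequence g h x τ j := by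
  set r := h * √(2 * b) with hr
  have hrpos : 0 < r := by have := hg.radius_pos; positivity
  -- Within distance `r` the weight is `g 0`. One third of `r` suffices both for two consecutive
  -- edges and for one edge at time `t + 1` plus two displacements.
  obtain ⟨t, ht⟩ := eventually_atTop.1
    (hg.eventually_short_edges hh x (by positivity : 0 < r / 3))
  have hδ := (ht t le_rfl).1
  have hedge := (ht t le_rfl).2
  have hclose : ∀ i j, ‖sequence g h x t i - sequence g h x t j‖ < r →
      radialWeight g (h⁻¹ • (sequence g h x t i - sequence g h x t j)) = g 0 := fun i j hij =>
    hg.radialWeight_eq_zero_of_norm_lt hh hij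
  -- Neighbors at time `t + 1` were within `r` at time `t`, hence already neighbors; it remains to
  -- see that their weights to every `l` at time `t` agree.
  refine ⟨t + 1, fun i j hij => step_eq_of_radialWeight_eq ?_⟩
  have hij' : ‖sequence g h x t i - sequence g h x t j‖ < r := by
    have h1 := (ht (t + 1) (by omega)).2 i j hij
    have h2 : sequence g h x t i - sequence g h x t j =
        (sequence g h x (t + 1) i - sequence g h x (t + 1) j) -
          (sequence g h x (t + 1) i - sequence g h x t i) +
          (sequence g h x (t + 1) j - sequence g h x t j) := by abel
    rw [h2]
    have h3 := norm_add_le ((sequence g h x (t + 1) i - sequence g h x (t + 1) j) -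
          (sequence g h x (t + 1) i - sequence g h x t i))
          (sequence g h x (t + 1) j - sequence g h x t j)
    have h4 := norm_sub_le (sequence g h x (t + 1) i - sequence g h x (t + 1) j)
          (sequence g h x (t + 1) i - sequence g h x t i)
    linarith [hδ i, hδ j]
  have hne : radialWeight g (h⁻¹ • (sequence g h x t i - sequence g h x t j)) ≠ 0 := by
    rw [hclose i j hij']; exact hg.zero_pos.ne'
  have htrans : ∀ p q l,
      radialWeight g (h⁻¹ • (sequence g h x t p - sequence g h x t q)) ≠ 0 →
      radialWeight g (h⁻¹ • (sequence g h x t q - sequence g h x t l)) ≠ 0 →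
      radialWeight g (h⁻¹ • (sequence g h x t p - sequence g h x t l)) = g 0 :=
    fun p q l hpq hql => hclose p l <| by
      have := norm_sub_le_norm_sub_add_norm_sub (sequence g h x t p) (sequence g h x t q)
        (sequence g h x t l)
      linarith [hedge p q hpq, hedge q l hql]
  have hne' : radialWeight g (h⁻¹ • (sequence g h x t j - sequence g h x t i)) ≠ 0 := by
    rwa [radialWeight_smul_sub_comm]
  have hself : ∀ p, radialWeight g (h⁻¹ • (sequence g h x t p - sequence g h x t p)) ≠ 0 :=
    fun p => by simpa [radialWeight] using hg.zero_pos.ne'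
  intro l
  by_cases hil : radialWeight g (h⁻¹ • (sequence g h x t i - sequence g h x t l)) = 0
  · by_cases hjl : radialWeight g (h⁻¹ • (sequence g h x t j - sequence g h x t l)) = 0
    · rw [hil, hjl]
    · exact absurd ((htrans i j l hne hjl).symm.trans hil) hg.zero_pos.ne'
  · rw [htrans i i l (hself i) hil, htrans j i l hne' hil]

end IsRegularWeight

end Dynamics

end BMS

namespace BMS

/-! ### The Epanechnikov kernel satisfies the assumptions. -/

section Epanechnikov

lemma integrable_epanechnikov (d : ℕ) :
    MeasureTheory.Integrable (fun v : Point d => max (1 - ‖v‖ ^ 2) 0) := by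
  apply Continuous.integrable_of_hasCompactSupport (by fun_prop)
  apply HasCompactSupport.intro (isCompact_closedBall (0 : Point d) 1)
  intro v hv
  rw [mem_closedBall_zero_iff, not_le] at hv
  exact max_eq_right (by nlinarith)

lemma epanechnikovIntegral_pos (d : ℕ) : 0 < ∫ v : Point d, max (1 - ‖v‖ ^ 2) 0 := by
  apply Continuous.integral_pos_of_hasCompactSupport_nonneg_nonzero (x := 0)
  · fun_prop
  · apply HasCompactSupport.intro (isCompact_closedBall (0 : Point d) 1)
    intro v hv
    rw [mem_closedBall_zero_iff, not_le] at hv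
    exact max_eq_right (by nlinarith)
  · exact fun v => le_max_right _ _
  · simp

lemma epanechnikovConst_pos (d : ℕ) : 0 < epanechnikovConst d :=
  inv_pos.2 (epanechnikovIntegral_pos d)

lemma hasDerivWithinAt_epanechnikovProfile (d : ℕ) :
    HasDerivWithinAt (epanechnikovProfile d) (epanechnikovConst d * -2) (Set.Ioi 0) 0 := by
  have h : HasDerivAt (fun u : ℝ => epanechnikovConst d * (1 - 2 * u))
      (epanechnikovConst d * -2) 0 := by
    simpa using (((hasDerivAt_id (0 : ℝ)).const_mul 2).const_sub 1).const_mul (epanechnikovConst d)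
  refine (h.congr_of_eventuallyEq ?_).hasDerivWithinAt
  filter_upwards [gt_mem_nhds (by norm_num : (0 : ℝ) < 1 / 2)] with u hu
  rw [epanechnikovProfile, max_eq_left (by linarith)]

lemma rightDerivZero_epanechnikovProfile (d : ℕ) :
    rightDerivZero (epanechnikovProfile d) = epanechnikovConst d * -2 :=
  (hasDerivWithinAt_epanechnikovProfile d).derivWithin (uniqueDiffWithinAt_Ioi 0)

lemma isKernelWithProfile_epanechnikov (d : ℕ) :
    IsKernelWithProfile (epanechnikovKernel d) (epanechnikovProfile d) where
  bounded := ⟨epanechnikovConst d, fun u => by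
    have hc := epanechnikovConst_pos d
    rw [epanechnikovKernel, abs_of_nonneg (by positivity)]
    exact mul_le_of_le_one_right hc.le (max_le (by nlinarith [sq_nonneg ‖u‖]) zero_le_one)⟩
  continuous := by unfold epanechnikovKernel; fun_prop
  nonneg u := mul_nonneg (epanechnikovConst_pos d).le (le_max_right _ _)
  integrable := (integrable_epanechnikov d).const_mul _
  normalized := by
    simp only [epanechnikovKernel, MeasureTheory.integral_const_mul]
    exact inv_mul_cancel₀ (epanechnikovIntegral_pos d).ne'
  radial u := by rw [epanechnikovKernel, epanechnikovProfile, mul_div_cancel₀ _ two_ne_zero]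
  convex := by
    have h : ConvexOn ℝ (Set.Ici (0 : ℝ)) fun u => 1 - 2 * u :=
      (convexOn_const 1 (convex_Ici 0)).sub ((concaveOn_id (convex_Ici 0)).smul zero_le_two)
    exact (h.sup (convexOn_const 0 (convex_Ici 0))).smul (epanechnikovConst_pos d).le
  nonincreasing u _ v _ huv :=
    mul_le_mul_of_nonneg_left (max_le_max_right _ (by linarith)) (epanechnikovConst_pos d).le
  rightDeriv_finite := (hasDerivWithinAt_epanechnikovProfile d).differentiableWithinAt

lemma truncationPoint_epanechnikovProfile (d : ℕ) : truncationPoint (epanechnikovProfile d) = 1 := by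
  apply le_antisymm
  · refine iSup₂_le fun u hu => ?_
    rw [ENNReal.ofReal_le_one]
    by_contra! h
    exact hu.2 (by rw [epanechnikovProfile, max_eq_right (by nlinarith), mul_zero])
  · refine le_of_forall_lt fun a ha => ?_
    obtain ⟨r, hr, rfl⟩ : ∃ r : ℝ, 0 ≤ r ∧ ENNReal.ofReal r = a :=
      ⟨a.toReal, ENNReal.toReal_nonneg, ENNReal.ofReal_toReal ha.ne_top⟩
    rw [ENNReal.ofReal_lt_one] at ha
    -- The supremum `1` is not attained, so a midpoint between `r` and `1` is used.
    have hmem : 0 ≤ (r + 1) / 2 ∧ epanechnikovProfile d (((r + 1) / 2) ^ 2 / 2) ≠ 0 := by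
      refine ⟨by linarith, (mul_pos (epanechnikovConst_pos d) (lt_max_of_lt_left ?_)).ne'⟩
      nlinarith
    refine lt_of_lt_of_le ?_ (le_iSup₂ (f := fun (u : ℝ)
      (_ : 0 ≤ u ∧ epanechnikovProfile d (u ^ 2 / 2) ≠ 0) => ENNReal.ofReal u) _ hmem)
    exact (ENNReal.ofReal_lt_ofReal_iff (by linarith)).2 (by linarith)

lemma isNonSmoothlyTruncated_epanechnikovProfile (d : ℕ) :
    IsNonSmoothlyTruncated (epanechnikovProfile d) := by
  have hc := epanechnikovConst_pos d
  refine ⟨by simp [truncationPoint_epanechnikovProfile], fun h => ?_⟩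
  rw [truncationPoint_epanechnikovProfile, ENNReal.toReal_one] at h
  set f : ℝ → ℝ := fun u => epanechnikovProfile d (u ^ 2 / 2)
  -- The one-sided derivatives at `1` differ: `0` from the right and a negative number from the
  -- left.
  have hr : HasDerivWithinAt f 0 (Set.Ici 1) 1 :=
    (hasDerivWithinAt_const (1 : ℝ) (Set.Ici 1) (0 : ℝ)).congr_of_mem (fun u hu => by
      have : (1 : ℝ) ≤ u := hu
      simp only [f]
      rw [epanechnikovProfile, max_eq_right (by nlinarith), mul_zero]) (by simp)
  have hl : HasDerivWithinAt f (epanechnikovConst d * -2) (Set.Icc 0 1) 1 := by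
    have h1 : HasDerivAt (fun u : ℝ => epanechnikovConst d * (1 - u ^ 2))
        (epanechnikovConst d * -2) 1 := by
      simpa using (((hasDerivAt_id (1 : ℝ)).pow 2).const_sub 1).const_mul (epanechnikovConst d)
    refine h1.hasDerivWithinAt.congr_of_mem (fun u hu => ?_) (by simp)
    simp only [f]
    rw [epanechnikovProfile, mul_div_cancel₀ _ two_ne_zero, max_eq_left (by nlinarith [hu.1, hu.2])]
  have e₁ := (uniqueDiffOn_Ici (1 : ℝ) 1 (by simp)).eq_deriv _ hr h.hasDerivAt.hasDerivWithinAt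
  have e₂ := (uniqueDiffOn_Icc (zero_lt_one' ℝ) 1 (by simp)).eq_deriv _ hl
    h.hasDerivAt.hasDerivWithinAt
  linarith

lemma isQuadraticNearZero_epanechnikovProfile (d : ℕ) :
    IsQuadraticNearZero (epanechnikovProfile d) := by
  refine ⟨1, one_pos, by simp [truncationPoint_epanechnikovProfile], fun u hu => ?_⟩
  rw [rightDerivZero_epanechnikovProfile, epanechnikovProfile, epanechnikovProfile,
    max_eq_left (by nlinarith [hu.1, hu.2]), max_eq_left (by norm_num)]
  ring

end Epanechnikov

end BMS

/-! ### Fixed configurations, limit points of components, and the theorem. -/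

namespace BMS

lemma sequence_eq_of_step_eq {n d : ℕ} {g : ℝ → ℝ} {h : ℝ} {x : Config n d} {τ : ℕ}
    (hτ : step g h (sequence g h x τ) = sequence g h x τ) :
    ∀ t ≥ τ, sequence g h x t = sequence g h x τ := by
  intro t ht
  induction t, ht using Nat.le_induction with
  | base => rfl
  | succ t _ ih => rw [sequence, ih, hτ]

/-- Positions are constant along walks, so they descend to components. Since `g 0 ≠ 0`, coinciding
points are adjacent, which makes the points of different components distinct. -/
lemma exists_connectedComponent_points {n d : ℕ} {g : ℝ → ℝ} {h : ℝ} {u : Config n d}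
    (hg0 : g 0 ≠ 0)
    (hu : ∀ i j, radialWeight g (h⁻¹ • (u i - u j)) ≠ 0 → u i = u j) :
    ∃ z : (graph g h u).ConnectedComponent → Point d,
      Function.Injective z ∧ ∀ m, ∀ i ∈ m.supp, u i = z m := by
  have hwalk : ∀ i j, (p : (graph g h u).Walk i j) → u i = u j := fun i j p => by
    induction p with
    | nil => rfl
    | cons hadj _ ih => exact (hu _ _ hadj.2).trans ih
  refine ⟨SimpleGraph.ConnectedComponent.lift u fun i j p _ => hwalk i j p, ?_, ?_⟩
  · intro m m'
    induction m using SimpleGraph.ConnectedComponent.ind with | _ i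
    induction m' using SimpleGraph.ConnectedComponent.ind with | _ j
    intro hij
    rw [SimpleGraph.ConnectedComponent.lift_mk, SimpleGraph.ConnectedComponent.lift_mk] at hij
    rw [SimpleGraph.ConnectedComponent.eq]
    rcases eq_or_ne i j with rfl | hne
    · exact SimpleGraph.Reachable.refl _
    · exact SimpleGraph.Adj.reachable ⟨hne, by simpa [radialWeight, hij] using hg0⟩
  · intro m i hi
    rw [SimpleGraph.ConnectedComponent.mem_supp_iff] at hi
    rw [← hi, SimpleGraph.ConnectedComponent.lift_mk]

end BMS

theorem mainTheorem3 (d : ℕ) :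
    (∀ (K : BMS.Point d → ℝ) (k g : ℝ → ℝ) (h : ℝ) (n : ℕ) (x : BMS.Config n d),
      BMS.IsKernelWithProfile K k →
      BMS.IsNonSmoothlyTruncated k →
      BMS.IsQuadraticNearZero k →
      BMS.IsWeightOf g k →
      0 < h →
      ∃ ybar : BMS.Config n d,
        Filter.Tendsto (BMS.sequence g h x) Filter.atTop (nhds ybar) ∧
        ∃ τ : ℕ,
          (∀ t ≥ τ, BMS.graph g h (BMS.sequence g h x t) = BMS.graph g h ybar) ∧
          ∃ z : (BMS.graph g h (BMS.sequence g h x τ)).ConnectedComponent → BMS.Point d,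
            Function.Injective z ∧
            ∀ t ≥ τ,
              BMS.sequence g h x t = ybar ∧
              (∀ m, ∀ i ∈ m.supp, BMS.sequence g h x t i = z m) ∧
              BMS.objective K h (BMS.sequence g h x t) = BMS.objective K h ybar) ∧
    (BMS.IsKernelWithProfile (BMS.epanechnikovKernel d) (BMS.epanechnikovProfile d) ∧
      BMS.IsNonSmoothlyTruncated (BMS.epanechnikovProfile d) ∧
      BMS.IsQuadraticNearZero (BMS.epanechnikovProfile d)) := by
  refine ⟨fun K k g h n x hK htr hq hw hh => ?_, BMS.isKernelWithProfile_epanechnikov d,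
    BMS.isNonSmoothlyTruncated_epanechnikovProfile d,
    BMS.isQuadraticNearZero_epanechnikovProfile d⟩
  obtain ⟨c, b, hg⟩ := hw.exists_isRegularWeight hK.convex hK.rightDeriv_finite hK.nonincreasing
    htr hq
  obtain ⟨τ, hτ⟩ := hg.exists_coincide hh x
  have hconst := BMS.sequence_eq_of_step_eq (hg.step_eq_self hτ)
  obtain ⟨z, hz, hzi⟩ := BMS.exists_connectedComponent_points hg.zero_pos.ne' hτ
  refine ⟨BMS.sequence g h x τ, tendsto_atTop_of_eventually_const hconst, τ,
    fun t ht => by rw [hconst t ht], z, hz, fun t ht => ?_⟩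
  rw [hconst t ht]
  exact ⟨rfl, hzi, rfl⟩
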